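/- Let $G$ be a group. Then $G$ is finite-by-abelian (that is, $G$ has a finite normal subgroup with abelian quotient; equivalently, the derived subgroup $G'$ is finite) if and only if both of the following hold: (i) $G$ is locally (soluble-by-finite), i.e. every finitely generated subgroup of $G$ has a soluble normal subgroup of finite index; (ii) $G$ has the property $\bar{\mathcal{K}}$, i.e. for each subgroup $X$ of $G$ the set of subgroups $\{[X,H] \mid H \leq G\}$ is finite, where $[X,H]$ denotes the subgroup generated by all commutators $[x,h]$ with $x\in X$, $h\in H$. -/

import Mathlib

/-- A group is finite-by-abelian if it has a finite normal subgroup with abelian quotient. -/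
def IsFiniteByAbelian (G : Type*) [Group G] : Prop :=
  ∃ (N : Subgroup G) (_ : N.Normal), Finite N ∧ ∀ a b : G ⧸ N, a * b = b * a

/-- Being finite-by-abelian amounts to finiteness of the derived subgroup. -/
theorem isFiniteByAbelian_iff_finite_commutator (G : Type*) [Group G] :
    IsFiniteByAbelian G ↔ Finite (commutator G) := by
  constructor
  · rintro ⟨N, hN, hfin, hab⟩
    have hle : commutator G ≤ N := by
      rw [commutator_def, Subgroup.commutator_le]
      intro a _ b _
      rw [← QuotientGroup.eq_one_iff]
      change (a * b * a⁻¹ * b⁻¹ : G ⧸ N) = 1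
      rw [hab a b]
      simp [mul_assoc]
    exact Finite.of_injective _ (Subgroup.inclusion_injective hle)
  · intro h
    exact ⟨commutator G, inferInstance, h, fun a b => mul_comm (G := Abelianization G) a b⟩

/-- A group is soluble-by-finite if it has a soluble normal subgroup of finite index. -/
def IsSolubleByFinite (G : Type*) [Group G] : Prop :=
  ∃ N : Subgroup G, N.Normal ∧ Group.IsSolvable N ∧ N.FiniteIndex

/-- A group is locally (soluble-by-finite) if all its finitely generated subgroups are
soluble-by-finite. -/
def IsLocallySolubleByFinite (G : Type*) [Group G] : Prop :=
  ∀ H : Subgroup G, H.FG → IsSolubleByFinite H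

/-- The property `K̄`: for each subgroup `X`, there are only finitely many subgroups of the form
`[X, H]` with `H ≤ G`. Here `⁅X, H⁆` is the subgroup generated by all commutators of an element
of `X` with an element of `H`. -/
def HasKBar (G : Type*) [Group G] : Prop :=
  ∀ X : Subgroup G, {K : Subgroup G | ∃ H : Subgroup G, K = ⁅X, H⁆}.Finite

/-!
If the derived subgroup `G'` is finite, each `⁅X, H⁆` is one of its finitely many subgroups, and
`C_G(G')` is a subgroup of finite index, nilpotent of class at most two; as the condition passes
to subgroups, `G` is locally soluble-by-finite.

For the converse, the core is `HasKBar.relIndex_centralizer_ne_zero`. Suppose `y ↦ ⁅g, y⁆` is a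
homomorphism from a subgroup `N` normalised by `g` onto an abelian subgroup `M`. Every
`g`-invariant subgroup of `M` has the form `⁅⟨g⟩, B⁆` with `B ≤ N`, so `K̄` allows only finitely many
of them. Thus `M` is a module with finitely many submodules over the group ring of an infinite
cyclic group, which is finitely generated and commutative. Such a module has finite length, with
composition factors that are residue fields of the ring, and these are finite by the
Nullstellensatz; so `M` is finite, and `C_N(g)` has finite index in `N`.

Now let `G` be finitely generated with `K̄`, and `A` an abelian normal subgroup such that the centre
of `G ⧸ A` has finite index. With `N = A` the core result shows that `A ∩ Z(G)` has finite index in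
`A`. With `N` the finite-index subgroup of all `y` such that `⁅g, y⁆ ∈ A ∩ Z(G)`, it shows that
every centraliser `C_G(g)` has finite index, hence so has `Z(G)`
(`HasKBar.finiteIndex_center_of_surjective`). Climbing the derived series of a soluble normal
subgroup of finite index gives that `Z(G)` has finite index in every finitely generated
soluble-by-finite group `G` with `K̄`, and `G'` is then finite by Schur's theorem.

When all finitely generated subgroups have finite derived subgroup, `K̄` for cyclic `X` shows that
conjugacy classes are finite. So the subgroups `⁅G, ⟨g⟩⁆` are finite, and `K̄` for `X = G` shows that
there are finitely many of them, whence finitely many commutators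
(`HasKBar.finite_commutatorSet`).
-/

open Subgroup
open scoped commutatorElement

/-! ### Modules with finitely many submodules -/

/-- A field that is finitely generated as an abelian group is finite. -/
theorem Field.finite_of_moduleFinite_int (K : Type*) [Field K] [Module.Finite ℤ K] : Finite K := by
  obtain ⟨p, hp⟩ := CharP.exists K
  rcases eq_or_ne p 0 with rfl | hp0
  · -- In characteristic zero `K` is integral over the subring `ℤ`, forcing `ℤ` to be a field.
    have := CharP.charP_to_charZero K
    exact absurd (isField_of_isIntegral_of_isField (R := ℤ) (S := K)
      (FaithfulSMul.algebraMap_injective ℤ K) (Field.toIsField K)) Int.not_isField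
  · refine Module.finite_of_fg_torsion K fun x => ?_
    refine ⟨⟨(p : ℤ), mem_nonZeroDivisors_of_ne_zero (by exact_mod_cast hp0)⟩, ?_⟩
    change (p : ℤ) • x = 0
    simp

/-- The maximal ideals `(p)` of `ℤ` with `p` prime intersect in `0`, as there are infinitely many
primes. -/
theorem Int.isJacobsonRing : IsJacobsonRing ℤ := by
  rw [isJacobsonRing_iff_sInf_maximal]
  intro I hI
  by_cases h0 : I = ⊥
  · refine ⟨{J | J.IsMaximal}, fun J hJ => Or.inl hJ, ?_⟩
    subst h0
    refine (le_antisymm bot_le fun x hx => ?_)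
    rw [Ideal.mem_bot]
    obtain ⟨p, hlt, hp⟩ := Nat.exists_infinite_primes (x.natAbs + 1)
    have hmax : (Ideal.span {(p : ℤ)}).IsMaximal :=
      PrincipalIdealRing.isMaximal_of_irreducible (Nat.prime_iff_prime_int.mp hp).irreducible
    have hdvd := Ideal.mem_span_singleton.mp (Ideal.mem_sInf.mp hx hmax)
    exact Int.eq_zero_of_abs_lt_dvd hdvd (by rw [Int.abs_eq_natAbs]; omega)
  · exact ⟨{I}, fun J hJ => Or.inl (hJ ▸ hI.isMaximal h0), by simp⟩

/-- A residue field of a finitely generated commutative ring is a finitely generated `ℤ`-module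
by the Nullstellensatz over the Jacobson ring `ℤ`. -/
theorem finite_quotient_of_isMaximal {R : Type*} [CommRing R] [Algebra.FiniteType ℤ R]
    (I : Ideal R) (hI : I.IsMaximal) : Finite (R ⧸ I) := by
  let := Ideal.Quotient.field I
  have := Int.isJacobsonRing
  have := finite_of_finite_type_of_isJacobsonRing ℤ (R ⧸ I)
  exact Field.finite_of_moduleFinite_int (R ⧸ I)

theorem IsFiniteLength.finite {R : Type*} [CommRing R] [Algebra.FiniteType ℤ R]
    {M : Type*} [AddCommGroup M] [Module R M] (h : IsFiniteLength R M) : Finite M := by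
  induction h with
  | of_subsingleton => exact Finite.of_subsingleton
  | @of_simple_quotient M _ _ N hsimple _ ih =>
    obtain ⟨I, hI, ⟨e⟩⟩ := isSimpleModule_iff_quot_maximal.mp hsimple
    have := finite_quotient_of_isMaximal I hI
    have : Finite (M ⧸ N) := Finite.of_equiv _ e.symm.toEquiv
    have : Finite (M ⧸ N.toAddSubgroup) := ‹Finite (M ⧸ N)›
    have : Finite N.toAddSubgroup := ih
    exact Finite.of_equiv _ (AddSubgroup.addGroupEquivQuotientProdAddSubgroup
      (s := N.toAddSubgroup)).symm

theorem Module.finite_of_finite_submodule (R : Type*) [CommRing R] [Algebra.FiniteType ℤ R]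
    (M : Type*) [AddCommGroup M] [Module R M] [Finite (Submodule R M)] : Finite M :=
  (isFiniteLength_iff_isNoetherian_isArtinian.mpr
    ⟨isNoetherian_iff'.mpr inferInstance, inferInstance⟩ : IsFiniteLength R M).finite


/-! ### Abelian subgroups with finitely many invariant subgroups -/

/-- An abelian subgroup normalised by `g` is a module over the Laurent polynomial ring
`ℤ[Multiplicative ℤ]`, and its submodules are the subgroups normalised by `g`. -/
theorem Subgroup.finite_of_finite_invariant {G : Type*} [Group G] (M : Subgroup G)
    (hcomm : ∀ x ∈ M, ∀ y ∈ M, x * y = y * x) {g : G} (hg : g ∈ normalizer (M : Set G))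
    (hfin : {L : Subgroup G | L ≤ M ∧ g ∈ normalizer (L : Set G)}.Finite) : Finite M := by
  let : CommGroup M :=
    { (inferInstance : Group M) with mul_comm := fun x y => Subtype.ext (hcomm x x.2 y y.2) }
  let act : MulDistribMulAction (Multiplicative ℤ) M :=
    MulDistribMulAction.compHom M (M.normalizerMonoidHom.comp (zpowersHom _ ⟨g, hg⟩))
  let ρ := Representation.ofMulDistribMulAction (Multiplicative ℤ) M
  let toSub : Submodule (MonoidAlgebra ℤ (Multiplicative ℤ)) ρ.asModule → Subgroup G := fun L =>
    (AddSubgroup.toSubgroup' (L.toAddSubgroup : AddSubgroup (Additive M))).map M.subtype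
  have hact (k : ℤ) (x : M) : ((Multiplicative.ofAdd k • x : M) : G) = g ^ k * x * (g ^ k)⁻¹ := by
    rfl
  have hmem (L) (x : G) :
      x ∈ toSub L ↔ ∃ y : M, (Additive.ofMul y : Additive M) ∈ L.toAddSubgroup ∧ (y : G) = x :=
    Iff.rfl
  have hstable (L) (k : ℤ) (x : G) (hx : x ∈ toSub L) : g ^ k * x * (g ^ k)⁻¹ ∈ toSub L := by
    obtain ⟨y, hy, rfl⟩ := (hmem L x).mp hx
    refine (hmem L _).mpr ⟨Multiplicative.ofAdd k • y, ?_, hact k y⟩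
    have h := L.smul_mem (MonoidAlgebra.of ℤ _ (Multiplicative.ofAdd k)) hy
    have h' := ρ.asModuleEquiv_symm_map_rho (Multiplicative.ofAdd k) (Additive.ofMul y)
    exact (congrArg (· ∈ L) h').mpr h
  have hmaps (L) : toSub L ∈ {L : Subgroup G | L ≤ M ∧ g ∈ normalizer (L : Set G)} := by
    refine ⟨?_, ?_⟩
    · rintro x hx
      obtain ⟨y, -, rfl⟩ := (hmem L x).mp hx
      exact y.2
    · rw [mem_normalizer_iff]
      refine fun x => ⟨fun hx => by simpa using hstable L 1 x hx, fun hx => ?_⟩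
      simpa [mul_assoc] using hstable L (-1) _ hx
  have hinj : Function.Injective toSub := by
    intro L L' h
    ext x
    have key (N) : x ∈ N ↔ ((Additive.toMul (ρ.asModuleEquiv x) : M) : G) ∈ toSub N := by
      rw [hmem]
      refine ⟨fun hx => ⟨_, hx, rfl⟩, ?_⟩
      rintro ⟨y, hy, hyx⟩
      rw [Subtype.ext hyx] at hy
      exact hy
    rw [key L, key L', h]
  have := hfin.to_subtype
  have : Finite (Submodule (MonoidAlgebra ℤ (Multiplicative ℤ)) ρ.asModule) :=
    Finite.of_injective (fun L => (⟨toSub L, hmaps L⟩ :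
      {L : Subgroup G | L ≤ M ∧ g ∈ normalizer (L : Set G)}))
      fun L L' h => hinj (congrArg Subtype.val h)
  -- The canonical `ℤ`-algebra structure of a ring agrees with that of a monoid algebra over `ℤ`
  -- only up to `Subsingleton`.
  have : @Algebra.FiniteType ℤ (MonoidAlgebra ℤ (Multiplicative ℤ)) _ _ (Ring.toIntAlgebra _) := by
    have h : Algebra.FiniteType ℤ (MonoidAlgebra ℤ (Multiplicative ℤ)) := inferInstance
    convert h
    · rfl
    · exact Subsingleton.elim _ _
  exact Module.finite_of_finite_submodule (MonoidAlgebra ℤ (Multiplicative ℤ)) ρ.asModule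

/-! ### Inheritance of the property `K̄` -/

theorem HasKBar.subgroup {G : Type*} [Group G] (hG : HasKBar G) (H : Subgroup G) : HasKBar H := by
  intro X
  refine Set.Finite.of_finite_image ((hG (X.map H.subtype)).subset ?_)
    (map_injective H.subtype_injective).injOn
  rintro _ ⟨_, ⟨Y, rfl⟩, rfl⟩
  exact ⟨Y.map H.subtype, map_commutator _ _ _⟩

theorem HasKBar.of_surjective {G Q : Type*} [Group G] [Group Q] (hG : HasKBar G) {f : G →* Q}
    (hf : Function.Surjective f) : HasKBar Q := by
  intro X
  refine ((hG (X.comap f)).image (map f)).subset ?_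
  rintro _ ⟨Y, rfl⟩
  exact ⟨_, ⟨Y.comap f, rfl⟩, by simp [map_commutator, map_comap_eq_self_of_surjective hf]⟩

/-! ### Commutators with a fixed element -/

/-- A subgroup is of finite index in `N` if it contains `x⁻¹ * y` whenever `x, y ∈ N` have the
same value under some function from `N` to a finite type. -/
theorem Subgroup.relIndex_ne_zero_of_finite_fibers {G α : Type*} [Group G] [Finite α]
    {H N : Subgroup G} (f : N → α) (hf : ∀ x y : N, f x = f y → (x⁻¹ * y : G) ∈ H) :
    H.relIndex N ≠ 0 := by
  have : Finite (N ⧸ H.subgroupOf N) := by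
    refine Finite.of_injective (fun q => f q.out) fun p q h => ?_
    rw [← p.out_eq', ← q.out_eq', QuotientGroup.eq, mem_subgroupOf]
    exact hf _ _ h
  exact (finiteIndex_of_finite_quotient (H := H.subgroupOf N)).index_ne_zero

/-- The hypotheses make `y ↦ ⁅g, y⁆` a homomorphism from `N` onto an abelian subgroup `M`
normalised by `g`. A subgroup `L ≤ M` normalised by `g` equals `⁅⟨g⟩, B⁆`, where `B ≤ N` is the
preimage of `L`; hence there are finitely many such `L`, and `M` is finite. -/
theorem HasKBar.relIndex_centralizer_ne_zero {G : Type*} [Group G] (hG : HasKBar G) {g : G}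
    {N : Subgroup G} (hgN : g ∈ normalizer (N : Set G))
    (hN : ∀ y ∈ N, ∀ z ∈ N, Commute y ⁅g, z⁆)
    (hcomm : ∀ y ∈ N, ∀ z ∈ N, Commute ⁅g, y⁆ ⁅g, z⁆) :
    (centralizer {g}).relIndex N ≠ 0 := by
  let φ : N →* G := MonoidHom.mk' (fun y => ⁅g, (y : G)⁆) fun y z => by
    have h : (y : G) * ⁅g, (z : G)⁆ * (y : G)⁻¹ = ⁅g, (z : G)⁆ := by
      rw [(hN y y.2 z z.2).eq, mul_inv_cancel_right]
    calc ⁅g, ((y * z : N) : G)⁆ = ⁅g, (y : G)⁆ * (y * ⁅g, (z : G)⁆ * (y : G)⁻¹) := by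
          simp only [commutatorElement_def, Subgroup.coe_mul]; group
      _ = _ := by rw [h]
  have hφ (y : N) : φ y = ⁅g, (y : G)⁆ := rfl
  have hconj (y : G) : g * ⁅g, y⁆ * g⁻¹ = ⁅g, g * y * g⁻¹⁆ := by
    simp only [commutatorElement_def]; group
  have hM : g ∈ normalizer (φ.range : Set G) := by
    rw [mem_normalizer_iff] at hgN ⊢
    intro x
    constructor
    · rintro ⟨y, rfl⟩
      exact ⟨⟨g * y * g⁻¹, (hgN y).mp y.2⟩, (hconj y).symm⟩
    · rintro ⟨y, hy⟩
      have hy' : g⁻¹ * y * g ∈ N := (hgN _).mpr (by simp [mul_assoc])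
      refine ⟨⟨g⁻¹ * y * g, hy'⟩, ?_⟩
      have h := hconj (g⁻¹ * y * g)
      rw [show g * (g⁻¹ * y * g) * g⁻¹ = (y : G) by group, ← hφ, hy] at h
      exact mul_left_cancel (mul_right_cancel h)
  have hL : {L : Subgroup G | L ≤ φ.range ∧ g ∈ normalizer (L : Set G)} ⊆
      {K | ∃ H, K = ⁅zpowers g, H⁆} := by
    rintro L ⟨hLM, hgL⟩
    refine ⟨(L.comap φ).map N.subtype, le_antisymm (fun x hx => ?_) ?_⟩
    · obtain ⟨y, rfl⟩ := hLM hx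
      exact commutator_mem_commutator (mem_zpowers g) ⟨y, hx, rfl⟩
    · rw [commutator_le]
      rintro _ hk _ ⟨b, hb, rfl⟩
      -- The `x` with `⁅x, b⁆ ∈ L` for all `b` in the preimage: closed under multiplication
      -- and inversion among the elements normalising `L`.
      let S : Subgroup G :=
        { carrier := {x | x ∈ normalizer (L : Set G) ∧ ∀ b ∈ L.comap φ, ⁅x, (b : G)⁆ ∈ L}
          one_mem' := ⟨one_mem _, fun b _ => by simp [one_mem]⟩
          mul_mem' := by
            rintro x y ⟨hx, hx'⟩ ⟨hy, hy'⟩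
            refine ⟨mul_mem hx hy, fun b hb => ?_⟩
            have : ⁅x * y, (b : G)⁆ = x * ⁅y, (b : G)⁆ * x⁻¹ * ⁅x, (b : G)⁆ := by
              simp only [commutatorElement_def]; group
            rw [this]
            exact mul_mem ((mem_normalizer_iff.mp hx _).mp (hy' b hb)) (hx' b hb)
          inv_mem' := by
            rintro x ⟨hx, hx'⟩
            refine ⟨inv_mem hx, fun b hb => (mem_normalizer_iff.mp hx _).mpr ?_⟩
            have : x * ⁅x⁻¹, (b : G)⁆ * x⁻¹ = ⁅x, (b : G)⁆⁻¹ := by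
              simp only [commutatorElement_def]; group
            rw [this]
            exact inv_mem (hx' b hb) }
      have hgS : zpowers g ≤ S := zpowers_le.mpr ⟨hgL, fun b hb => hb⟩
      exact (hgS hk).2 b hb
  have hfin : Finite φ.range := by
    refine finite_of_finite_invariant φ.range ?_ hM ((hG (zpowers g)).subset hL)
    rintro _ ⟨y, rfl⟩ _ ⟨z, rfl⟩
    exact hcomm y y.2 z z.2
  refine relIndex_ne_zero_of_finite_fibers φ.rangeRestrict fun x y h => ?_
  have h1 : φ (x⁻¹ * y) = 1 := by
    have h' : φ x = φ y := congrArg Subtype.val h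
    rw [map_mul, map_inv, h', inv_mul_cancel]
  rw [hφ, commutatorElement_eq_one_iff_mul_comm] at h1
  exact mem_centralizer_singleton_iff.mpr (by simpa using h1.symm)

/-! ### Finitely generated soluble-by-finite groups -/

theorem Subgroup.relIndex_center_ne_zero {G : Type*} [Group G] [Group.FG G] {A : Subgroup G}
    (h : ∀ g : G, (centralizer {g}).relIndex A ≠ 0) : (center G).relIndex A ≠ 0 := by
  obtain ⟨s, hs, hfin⟩ := Group.fg_iff.mp (inferInstance : Group.FG G)
  have := hfin.to_subtype
  rw [center_eq_iInf hs, iInf_subtype']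
  exact relIndex_iInf_ne_zero fun i => h i

theorem Subgroup.mem_comap_centralizer_iff {G K : Type*} [Group G] [Group K] (f : G →* K)
    {g y : G} : y ∈ (centralizer {f g}).comap f ↔ ⁅g, y⁆ ∈ f.ker := by
  rw [mem_comap, mem_centralizer_singleton_iff, MonoidHom.mem_ker, map_commutatorElement,
    commutatorElement_eq_one_iff_mul_comm, eq_comm]

/-- Let `A = ker f` and `Z = A ∩ Z(G)`. By `HasKBar.relIndex_centralizer_ne_zero` applied to
`A`, `Z` has finite index in `A`. So for each `g` the subgroup of all `y` with `⁅g, y⁆ ∈ Z` has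
finite index in `G`, and the same result applies to it. -/
theorem HasKBar.finiteIndex_center_of_surjective {G Q : Type*} [Group G] [Group Q] [Group.FG G]
    (hG : HasKBar G) {f : G →* Q} (hf : Function.Surjective f)
    (hker : ∀ x ∈ f.ker, ∀ y ∈ f.ker, Commute x y) (hQ : (center Q).FiniteIndex) :
    (center G).FiniteIndex := by
  have hA (g y : G) (hy : y ∈ f.ker) : ⁅g, y⁆ ∈ f.ker := by
    rw [MonoidHom.mem_ker] at hy ⊢
    simp [map_commutatorElement, hy]
  have hZ : (center G ⊓ f.ker).relIndex f.ker ≠ 0 := by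
    rw [inf_relIndex_right]
    refine relIndex_center_ne_zero fun g => hG.relIndex_centralizer_ne_zero ?_
      (fun y hy z hz => hker _ hy _ (hA g z hz))
      (fun y hy z hz => hker _ (hA g y hy) _ (hA g z hz))
    rw [normalizer_eq_top]
    trivial
  suffices h : (center G).relIndex ⊤ ≠ 0 from ⟨by rwa [relIndex_top_right] at h⟩
  refine relIndex_center_ne_zero fun g => ?_
  set Z := center G ⊓ f.ker
  have hN : ((centralizer {f g}).comap f).relIndex ⊤ ≠ 0 := by
    have : (centralizer {f g}).FiniteIndex := finiteIndex_of_le (center_le_centralizer _)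
    rw [relIndex_top_right, index_comap_of_surjective _ hf]
    exact this.index_ne_zero
  have hcentZ (y : G) : y ∈ (centralizer {QuotientGroup.mk' Z g}).comap (QuotientGroup.mk' Z) ↔
      ⁅g, y⁆ ∈ Z := by
    rw [mem_comap_centralizer_iff, QuotientGroup.ker_mk']
  have hN₂ : ((centralizer {QuotientGroup.mk' Z g}).comap (QuotientGroup.mk' Z)).relIndex
      ((centralizer {f g}).comap f) ≠ 0 := by
    have : Finite (f.ker ⧸ Z.subgroupOf f.ker) := by
      have : (Z.subgroupOf f.ker).FiniteIndex := ⟨hZ⟩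
      infer_instance
    refine relIndex_ne_zero_of_finite_fibers
      (fun y => (QuotientGroup.mk (⟨⁅g, (y : G)⁆, (mem_comap_centralizer_iff f).mp y.2⟩ : f.ker) :
        f.ker ⧸ Z.subgroupOf f.ker)) fun x y h => ?_
    rw [QuotientGroup.eq, mem_subgroupOf] at h
    rw [hcentZ]
    have hxy : ⁅g, (x : G)⁻¹ * (y : G)⁆ =
        (x : G)⁻¹ * (⁅g, (x : G)⁆⁻¹ * ⁅g, (y : G)⁆) * ((x : G)⁻¹)⁻¹ := by
      simp only [commutatorElement_def]; group
    change ⁅g, (x : G)⁻¹ * (y : G)⁆ ∈ Z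
    rw [hxy]
    exact Normal.conj_mem inferInstance _ h _
  refine relIndex_ne_zero_trans (hG.relIndex_centralizer_ne_zero ?_ ?_ ?_)
    (relIndex_ne_zero_trans hN₂ hN)
  · exact le_normalizer ((hcentZ g).mpr (by simp [one_mem]))
  · intro y _ z hz
    exact mem_center_iff.mp ((hcentZ z).mp hz).1 y
  · intro y _ z hz
    exact mem_center_iff.mp ((hcentZ z).mp hz).1 _

theorem HasKBar.finiteIndex_center {G : Type*} [Group G] [Group.FG G] (hG : HasKBar G)
    (hsol : IsSolubleByFinite G) : (center G).FiniteIndex := by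
  obtain ⟨S, hS, ⟨n, hn⟩, hfin⟩ := hsol
  let D (k : ℕ) : Subgroup G := (derivedSeries S k).map S.subtype
  have hD (k : ℕ) : (D k).Normal :=
    have := derivedSeries_characteristic S k
    ConjAct.normal_of_characteristic_of_normal
  have key (k : ℕ) : (center (G ⧸ D k)).FiniteIndex := by
    induction k with
    | zero =>
      have h0 : D 0 = S := by simp [D, ← MonoidHom.range_eq_map]
      have : (D 0).FiniteIndex := by rwa [h0]
      infer_instance
    | succ k ih =>
      have hsucc : D (k + 1) = ⁅D k, D k⁆ := by simp [D, map_commutator]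
      have hle : D (k + 1) ≤ D k := map_mono (derivedSeries_antitone S k.le_succ)
      refine (hG.of_surjective (QuotientGroup.mk'_surjective (D (k + 1)))
        ).finiteIndex_center_of_surjective
        (f := QuotientGroup.map (D (k + 1)) (D k) (MonoidHom.id G) hle) ?_ ?_ ih
      · exact QuotientGroup.map_surjective_of_surjective _ _ _ (QuotientGroup.mk_surjective) _
      · intro x hx y hy
        obtain ⟨x, rfl⟩ := QuotientGroup.mk_surjective x
        obtain ⟨y, rfl⟩ := QuotientGroup.mk_surjective y
        have hx' : x ∈ D k := (QuotientGroup.eq_one_iff x).mp hx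
        have hy' : y ∈ D k := (QuotientGroup.eq_one_iff y).mp hy
        have h : ⁅x, y⁆ ∈ D (k + 1) := hsucc ▸ commutator_mem_commutator hx' hy'
        exact commutatorElement_eq_one_iff_mul_comm.mp ((QuotientGroup.eq_one_iff _).mpr h)
  refine hG.finiteIndex_center_of_surjective (QuotientGroup.mk'_surjective (D n)) ?_ (key n)
  have hbot : D n = ⊥ := by simp [D, hn]
  rw [QuotientGroup.ker_mk', hbot]
  intro x hx y _
  rw [mem_bot.mp hx]
  exact Commute.one_left y

/-- A form of Schur's theorem: a commutator depends only on the classes of its entries modulo the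
centre. -/
theorem Subgroup.finite_commutator_self {G : Type*} [Group G] {H : Subgroup G}
    (hH : (center H).FiniteIndex) : Finite (⁅H, H⁆ : Subgroup G) := by
  have hl (x y : H) (z : center H) : ⁅x * z, y⁆ = ⁅x, y⁆ := by
    have h : ⁅(z : H), y⁆ = 1 :=
      commutatorElement_eq_one_iff_mul_comm.mpr (mem_center_iff.mp z.2 y).symm
    calc ⁅x * z, y⁆ = x * ⁅(z : H), y⁆ * x⁻¹ * ⁅x, y⁆ := by
          simp only [commutatorElement_def]; group
      _ = ⁅x, y⁆ := by rw [h]; group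
  have hr (x y : H) (w : center H) : ⁅x, y * w⁆ = ⁅x, y⁆ := by
    rw [← commutatorElement_inv, hl, commutatorElement_inv]
  have hsub : commutatorSet H ⊆
      Set.range fun p : (H ⧸ center H) × (H ⧸ center H) => ⁅p.1.out, p.2.out⁆ := by
    rintro _ ⟨x, y, rfl⟩
    refine ⟨(x, y), ?_⟩
    obtain ⟨z, hz⟩ := QuotientGroup.mk_out_eq_mul (center H) x
    obtain ⟨w, hw⟩ := QuotientGroup.mk_out_eq_mul (center H) y
    simp only [hz, hw, hl, hr]
  have : Finite (commutatorSet H) := (Set.finite_range _).subset hsub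
  have h := map_subtype_commutator H
  rw [← h]
  exact Finite.of_surjective _ ((H.subtype).subgroupMap_surjective (_root_.commutator H))

/-! ### From finitely generated subgroups to the whole group -/

/-- Each subgroup `⁅⟨g⟩, ⟨y⟩⁆` is finite, and for fixed `g` finitely many occur, so that `g` has
finitely many conjugates. Hence `⁅G, ⟨g⟩⁆` is contained in `⁅H, H⁆` for a finitely generated `H`
and so is finite; finitely many of these subgroups occur, and they contain all commutators. -/
theorem HasKBar.finite_commutatorSet {G : Type*} [Group G] (hG : HasKBar G)
    (hloc : ∀ H : Subgroup G, H.FG → Finite (⁅H, H⁆ : Subgroup G)) :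
    (commutatorSet G).Finite := by
  have hconj (g : G) : (Set.range fun y : G => ⁅g, y⁆).Finite := by
    have hK : {K : Subgroup G | ∃ y : G, K = ⁅zpowers g, zpowers y⁆}.Finite :=
      (hG (zpowers g)).subset fun K ⟨y, hy⟩ => ⟨zpowers y, hy⟩
    refine (hK.biUnion (t := fun K => (K : Set G)) ?_).subset ?_
    · rintro _ ⟨y, rfl⟩
      have := hloc (closure {g, y}) ((fg_iff _).mpr ⟨_, rfl, by simp⟩)
      refine (Set.toFinite ((⁅closure {g, y}, closure {g, y}⁆ : Subgroup G) : Set G)).subset ?_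
      exact commutator_mono (zpowers_le.mpr (subset_closure (by simp)))
        (zpowers_le.mpr (subset_closure (by simp)))
    · rintro _ ⟨y, rfl⟩
      exact Set.mem_biUnion ⟨y, rfl⟩
        (commutator_mem_commutator (mem_zpowers g) (mem_zpowers y))
  have hfin (g : G) : Finite (⁅(⊤ : Subgroup G), zpowers g⁆ : Subgroup G) := by
    obtain ⟨T, -, hT⟩ := Set.exists_subset_bijOn Set.univ fun y : G => ⁅g, y⁆
    have hT' : T.Finite := hT.finite_iff_finite.mpr (by simpa using hconj g)
    have := hloc (closure (insert g T)) ((fg_iff _).mpr ⟨_, rfl, hT'.insert g⟩)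
    refine Set.Finite.subset
      (Set.toFinite ((⁅closure (insert g T), closure (insert g T)⁆ : Subgroup G) : Set G)) ?_
    change ⁅(⊤ : Subgroup G), zpowers g⁆ ≤ _
    rw [commutator_le]
    rintro y - _ ⟨i, rfl⟩
    obtain ⟨t, ht, hty⟩ := hT.surjOn ⟨y, trivial, rfl⟩
    -- `y` and `t` conjugate `g`, hence each power of `g`, in the same way.
    have h1 : t * g * t⁻¹ = y * g * y⁻¹ := by
      have h2 : ⁅g, t⁆⁻¹ * g = ⁅g, y⁆⁻¹ * g := congrArg (fun x => x⁻¹ * g) hty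
      simpa [commutatorElement_def, mul_assoc] using h2
    have h3 : ⁅y, g ^ i⁆ = ⁅t, g ^ i⁆ := by
      simp only [commutatorElement_def]
      rw [← conj_zpow, ← conj_zpow, h1]
    simp only [h3]
    exact commutator_mem_commutator (subset_closure (Set.mem_insert_of_mem g ht))
      (zpow_mem (subset_closure (Set.mem_insert g T)) i)
  have hK : {K : Subgroup G | ∃ g : G, K = ⁅(⊤ : Subgroup G), zpowers g⁆}.Finite :=
    (hG ⊤).subset fun K ⟨g, hg⟩ => ⟨zpowers g, hg⟩
  refine (hK.biUnion (t := fun K => (K : Set G)) ?_).subset ?_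
  · rintro _ ⟨g, rfl⟩
    exact hfin g
  · rintro _ ⟨x, g, rfl⟩
    exact Set.mem_biUnion ⟨g, rfl⟩ (commutator_mem_commutator (mem_top x) (mem_zpowers g))

/-! ### Groups with finite derived subgroup -/

/-- The centraliser of the finite normal subgroup `G'` has finite index, and is nilpotent of class
at most two. -/
theorem isSolubleByFinite_of_finite_commutator (G : Type*) [Group G] [Finite (commutator G)] :
    IsSolubleByFinite G := by
  let C : Subgroup G := centralizer (commutator G : Set G)
  have hC : C = (MulAut.conjNormal : G →* MulAut (commutator G)).ker := by
    ext x
    rw [MonoidHom.mem_ker, mem_centralizer_iff, MulEquiv.ext_iff]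
    simp [Subtype.ext_iff, mul_inv_eq_iff_eq_mul, eq_comm (b := x * _)]
  refine ⟨C, hC ▸ inferInstance, ⟨2, ?_⟩, ?_⟩
  · rw [derivedSeries_succ, derivedSeries_one, commutator_eq_bot_iff_le_centralizer]
    have h : commutator C ≤ center C := by
      rw [_root_.commutator_def, commutator_le]
      rintro x - y -
      rw [mem_center_iff]
      intro c
      exact Subtype.ext (mem_centralizer_iff.mp c.2 _
        (commutator_mem_commutator (mem_top (x : G)) (mem_top (y : G)))).symm
    exact h.trans (center_le_centralizer _)
  · have : Finite (MulAut (commutator G)) :=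
      Finite.of_injective (fun e => (e : commutator G → commutator G)) DFunLike.coe_injective
    rw [hC]
    exact finiteIndex_ker _

theorem hasKBar_of_finite_commutator (G : Type*) [Group G] [Finite (commutator G)] :
    HasKBar G := by
  intro X
  have : {K : Subgroup G | K ≤ commutator G}.Finite := by
    refine Set.Finite.of_finite_image (f := fun K : Subgroup G => (K : Set G))
      ((Set.toFinite (commutator G : Set G)).finite_subsets.subset ?_)
      SetLike.coe_injective.injOn
    rintro _ ⟨K, hK, rfl⟩
    exact hK
  refine this.subset ?_
  rintro _ ⟨H, rfl⟩
  exact commutator_mono le_top le_top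

theorem theoremA (G : Type*) [Group G] :
    IsFiniteByAbelian G ↔ IsLocallySolubleByFinite G ∧ HasKBar G := by
  rw [isFiniteByAbelian_iff_finite_commutator]
  constructor
  · intro h
    refine ⟨fun H _ => ?_, hasKBar_of_finite_commutator G⟩
    have hle : (commutator H).map H.subtype ≤ commutator G := by
      rw [map_subtype_commutator]
      exact commutator_mono le_top le_top
    have : Finite (commutator H) :=
      Finite.of_injective (fun x => (⟨x, hle ⟨x, x.2, rfl⟩⟩ : commutator G))
        fun x y hxy => Subtype.ext (Subtype.ext (Subtype.mk.inj hxy))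
    exact isSolubleByFinite_of_finite_commutator H
  · rintro ⟨hloc, hG⟩
    have : Finite (commutatorSet G) := hG.finite_commutatorSet fun H hH => by
      have : Group.FG H := (Group.fg_iff_subgroup_fg H).mpr hH
      exact finite_commutator_self ((hG.subgroup H).finiteIndex_center (hloc H hH))
    infer_instance
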